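/- **Proposition (Relative delta-method).** Let $\mathbb{D}$ and $\mathbb{E}$ be metrizable real topological vector spaces, with $\mathbb{E}$ locally convex. Let $X_n\colon\Omega_n\to\mathbb{D}$ and $Y_n\colon\Omega_n'\to\mathbb{D}$, $n\in\mathbb{N}$, be arbitrary (not necessarily measurable) maps defined on probability spaces, let $r_n\in\mathbb{R}$ with $r_n\to\infty$, let $\mathbb{D}_0\subset\mathbb{D}$ be open, and let $\theta_n\in\mathbb{D}_0$ be relatively compact in $\mathbb{D}_0$, i.e. every subsequence of $(\theta_n)$ has a further subsequence converging to a point of $\mathbb{D}_0$. Let $\phi\colon\mathbb{D}\to\mathbb{E}$ be continuously Hadamard-differentiable in $\mathbb{D}_0$ with derivatives $\phi'_\theta$: for each $\theta\in\mathbb{D}_0$ the map $\phi'_\theta\colon\mathbb{D}\to\mathbb{E}$ is continuous and linear, $$\frac{\phi(\theta+t_nh_n)-\phi(\theta)}{t_n}\to\phi'_\theta(h)\qquad\text{whenever } 0\neq t_n\to0 \text{ in } \mathbb{R} \text{ and } h_n\to h \text{ in } \mathbb{D},$$ and $\phi'_\theta$ is continuous in $\theta\in\mathbb{D}_0$, in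 the sense that $(\theta,h)\mapsto\phi'_\theta(h)$ is continuous on $\mathbb{D}_0\times\mathbb{D}$ (equivalently, $\theta\mapsto\phi'_\theta$ is continuous for uniform convergence on compact sets). Two sequences of maps $U_n, V_n$ with values in the same space $S$ are called relatively weakly convergent, written $U_n\leftrightarrow_d V_n$, if $|\mathrm{E}^*f(U_n)-\mathrm{E}^*f(V_n)|\to0$ for all bounded continuous $f\colon S\to\mathbb{R}$, where $\mathrm{E}^*$ is outer expectation. The sequence $Y_n$ is called relatively compact if every subsequence has a further subsequence $Y_{n_k}$ for which there is a tight Borel probability measure $\nu$ on $\mathbb{D}$ with $\mathrm{E}^*f(Y_{n_k})\to\int f\,d\nu$ for all bounded continuous $f\colon\mathbb{D}\to\mathbb{R}$. If $Y_n$ is relatively compact and $$r_n(X_n-\theta_n)\leftrightarrow_d Y_n,$$ then $$r_n\bigl(\phi(X_n)-\phi(\theta_n)\bigr)\leftrightarrow_d\phi'_{\theta_n}(Y_n).$$ -/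

import Mathlib

open Filter Topology MeasureTheory
open scoped BoundedContinuousFunction

noncomputable section

namespace RelWeak

/-- Outer expectation `E^* Z` of a not necessarily measurable function `Z`: the infimum of `E U` over
the integrable measurable majorants `U` of `Z`. It is only ever applied to bounded functions `Z`; for
these, allowing extended-real majorants whose expectation exists gives the same infimum. -/
def outerExpectation {Ω : Type*} [MeasurableSpace Ω] (P : Measure Ω) (Z : Ω → ℝ) : ℝ :=
  sInf {a : ℝ | ∃ U : Ω → ℝ, Measurable U ∧ Integrable U P ∧ (∀ ω, Z ω ≤ U ω) ∧ a = ∫ ω, U ω ∂P}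

/-- `X n → ν` weakly in the sense of Hoffmann-Jørgensen, where the `X n : Ω n → S` are arbitrary maps
and `ν` is a Borel law on `S`. -/
def ConvergesWeakly {S : Type*} [TopologicalSpace S] [MeasurableSpace S]
    {Ω : ℕ → Type*} [∀ n, MeasurableSpace (Ω n)] (P : ∀ n, Measure (Ω n))
    (X : ∀ n, Ω n → S) (ν : ProbabilityMeasure S) : Prop :=
  ∀ f : S →ᵇ ℝ,
    Tendsto (fun n => outerExpectation (P n) (fun ω => f (X n ω))) atTop
      (𝓝 (∫ x, f x ∂(ν : Measure S)))

/-- Relative compactness of a sequence of arbitrary maps: every subsequence contains a further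
subsequence which converges weakly to a tight Borel law. -/
def IsRelativelyCompact {S : Type*} [TopologicalSpace S] [MeasurableSpace S]
    {Ω : ℕ → Type*} [∀ n, MeasurableSpace (Ω n)] (P : ∀ n, Measure (Ω n))
    (X : ∀ n, Ω n → S) : Prop :=
  ∀ k : ℕ → ℕ, StrictMono k → ∃ l : ℕ → ℕ, StrictMono l ∧ ∃ ν : ProbabilityMeasure S,
    IsTightMeasureSet {(ν : Measure S)} ∧
      ConvergesWeakly (fun i => P (k (l i))) (fun i => X (k (l i))) ν

/-- Relative weak convergence `X n ↔ Y n`: `|E^* f(X n) - E^* f(Y n)| → 0` for every bounded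
continuous real function `f`. -/
def RelativelyWeaklyConvergent {S : Type*} [TopologicalSpace S]
    {Ω : ℕ → Type*} [∀ n, MeasurableSpace (Ω n)] (P : ∀ n, Measure (Ω n)) (X : ∀ n, Ω n → S)
    {Ω' : ℕ → Type*} [∀ n, MeasurableSpace (Ω' n)] (P' : ∀ n, Measure (Ω' n)) (Y : ∀ n, Ω' n → S) :
    Prop :=
  ∀ f : S →ᵇ ℝ,
    Tendsto (fun n => |outerExpectation (P n) (fun ω => f (X n ω)) -
      outerExpectation (P' n) (fun ω => f (Y n ω))|) atTop (𝓝 0)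

/-- A sequence of points is relatively compact in `U`: every subsequence contains a further
subsequence which converges to a point of `U`. -/
def IsRelativelyCompactSeqIn {S : Type*} [TopologicalSpace S] (U : Set S) (θ : ℕ → S) : Prop :=
  ∀ k : ℕ → ℕ, StrictMono k → ∃ l : ℕ → ℕ, StrictMono l ∧ ∃ a ∈ U,
    Tendsto (fun i => θ (k (l i))) atTop (𝓝 a)

section Hadamard

variable {D E : Type*} [AddCommGroup D] [Module ℝ D] [TopologicalSpace D]
  [AddCommGroup E] [Module ℝ E] [TopologicalSpace E]

/-- The continuous linear map `L` is the Hadamard derivative of `φ` at `θ`. -/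
def HasHadamardDerivAt (φ : D → E) (L : D →L[ℝ] E) (θ : D) : Prop :=
  ∀ (t : ℕ → ℝ) (h : ℕ → D) (h₀ : D), (∀ n, t n ≠ 0) → Tendsto t atTop (𝓝 0) →
    Tendsto h atTop (𝓝 h₀) →
      Tendsto (fun n => (t n)⁻¹ • (φ (θ + t n • h n) - φ θ)) atTop (𝓝 (L h₀))

/-- `φ` is continuously Hadamard-differentiable in `U` with derivative `φ'`. Continuity of
`θ ↦ φ' θ` is meant in the topology of uniform convergence on compact sets; between metrizable
spaces this is the same as joint continuity of `(θ, h) ↦ φ' θ h`. -/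
def HasContinuousHadamardDerivOn (φ : D → E) (φ' : D → D →L[ℝ] E) (U : Set D) : Prop :=
  (∀ θ ∈ U, HasHadamardDerivAt φ (φ' θ) θ) ∧
    ContinuousOn (fun p : D × D => φ' p.1 p.2) (U ×ˢ Set.univ)

end Hadamard

end RelWeak

end

/-!
Pass to a subsequence along which `θ n → a ∈ D₀` and `Y n` converges weakly to a tight law `ν`; then
`Z n = r n • (X n - θ n)` converges weakly to `ν` as well, and it is enough to show that both sides
converge weakly to the image of `ν` under `φ' a`. For the right-hand side this is the continuous
mapping theorem for the maps `φ' (θ n)`. The left-hand side is the image of `Z n` under the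
difference quotient `z ↦ r n • (φ (θ n + (r n)⁻¹ • z) - φ (θ n))`, so the same theorem applies as
soon as these quotients converge to `φ' a`, uniformly near each point. That is a mean value theorem:
by Hahn–Banach, a difference quotient lies in every open convex set containing the derivatives along
the segment, and `E` is locally convex. Tightness of `ν` enters through the continuous mapping
theorem, where convergence uniformly near each point is uniform near a compact set of almost full
mass.
-/

namespace RelWeak

section OuterExpectation

theorem outerExpectation_mono {Ω : Type*} [MeasurableSpace Ω] {P : Measure Ω} [IsFiniteMeasure P]
    {Z Z' : Ω → ℝ} (hZ : BddBelow (Set.range Z)) (hZ' : BddAbove (Set.range Z'))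
    (h : ∀ ω, Z ω ≤ Z' ω) : outerExpectation P Z ≤ outerExpectation P Z' := by
  obtain ⟨a, ha⟩ := hZ
  obtain ⟨b, hb⟩ := hZ'
  rw [mem_lowerBounds, Set.forall_mem_range] at ha
  rw [mem_upperBounds, Set.forall_mem_range] at hb
  refine csInf_le_csInf ⟨∫ _, a ∂P, ?_⟩
    ⟨∫ _, b ∂P, fun _ => b, measurable_const, integrable_const b, hb, rfl⟩ ?_
  · rintro _ ⟨U, -, hU, hZU, rfl⟩
    exact integral_mono (integrable_const a) hU fun ω => (ha ω).trans (hZU ω)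
  · rintro _ ⟨U, hUm, hU, hZU, rfl⟩
    exact ⟨U, hUm, hU, fun ω => (h ω).trans (hZU ω), rfl⟩

end OuterExpectation

section RelativeWeakConvergence

variable {S : Type*} [TopologicalSpace S]
  {Ω : ℕ → Type*} [∀ n, MeasurableSpace (Ω n)] {P : ∀ n, Measure (Ω n)} {X : ∀ n, Ω n → S}
  {Ω' : ℕ → Type*} [∀ n, MeasurableSpace (Ω' n)] {P' : ∀ n, Measure (Ω' n)} {Y : ∀ n, Ω' n → S}

theorem RelativelyWeaklyConvergent.comp_tendsto (h : RelativelyWeaklyConvergent P X P' Y)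
    {j : ℕ → ℕ} (hj : Tendsto j atTop atTop) :
    RelativelyWeaklyConvergent (fun i => P (j i)) (fun i => X (j i))
      (fun i => P' (j i)) (fun i => Y (j i)) :=
  fun f => (h f).comp hj

theorem relativelyWeaklyConvergent_of_subseq
    (h : ∀ k : ℕ → ℕ, StrictMono k → ∃ l : ℕ → ℕ,
      RelativelyWeaklyConvergent (fun i => P (k (l i))) (fun i => X (k (l i)))
        (fun i => P' (k (l i))) (fun i => Y (k (l i)))) :
    RelativelyWeaklyConvergent P X P' Y := by
  refine fun f => tendsto_of_subseq_tendsto fun ns hns => ?_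
  obtain ⟨m, -, hm⟩ := strictMono_subseq_of_tendsto_atTop hns
  obtain ⟨l, hl⟩ := h (ns ∘ m) hm
  exact ⟨m ∘ l, hl f⟩

variable [MeasurableSpace S] {ν : ProbabilityMeasure S}

theorem RelativelyWeaklyConvergent.convergesWeakly (h : RelativelyWeaklyConvergent P X P' Y)
    (hY : ConvergesWeakly P' Y ν) : ConvergesWeakly P X ν := fun f => by
  simpa using ((tendsto_zero_iff_abs_tendsto_zero _).2 (h f)).add (hY f)

theorem ConvergesWeakly.relativelyWeaklyConvergent (hX : ConvergesWeakly P X ν)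
    (hY : ConvergesWeakly P' Y ν) : RelativelyWeaklyConvergent P X P' Y := fun f => by
  simpa using ((hX f).sub (hY f)).abs

end RelativeWeakConvergence

section TightMeasure

variable {S ι β : Type*} [TopologicalSpace S] [PseudoMetricSpace β] {p : Filter ι}
  {g : ι → S → β} {F : S → β}

theorem exists_isOpen_superset_eventually_forall_dist_lt
    (hg : TendstoLocallyUniformly g F p) {K : Set S} (hK : IsCompact K) {δ : ℝ} (hδ : 0 < δ) :
    ∃ G, IsOpen G ∧ K ⊆ G ∧ ∀ᶠ i in p, ∀ x ∈ G, dist (g i x) (F x) < δ := by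
  have hmem : {q : S × ι | dist (g q.2 q.1) (F q.1) < δ} ∈ 𝓝ˢ K ×ˢ p := by
    refine hK.mem_nhdsSet_prod_of_forall fun x _ => ?_
    have hclose := tendstoLocallyUniformly_iff_forall_tendsto.1 hg x (Metric.dist_mem_uniformity hδ)
    rw [prod_comm, mem_map]
    filter_upwards [hclose] with q hq
    exact (dist_comm _ _).trans_lt hq
  obtain ⟨A, hA, B, hB, hAB⟩ := mem_prod_iff.1 hmem
  obtain ⟨G, hG, hKG, hGA⟩ := mem_nhdsSet_iff_exists.1 hA
  exact ⟨G, hG, hKG, eventually_of_mem hB fun i hi x hx => hAB (Set.mk_mem_prod (hGA hx) hi)⟩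

variable [CompletelyRegularSpace S]

theorem exists_boundedContinuous_zero_one_of_isCompact {K G : Set S} (hK : IsCompact K)
    (hG : IsOpen G) (hKG : K ⊆ G) :
    ∃ χ : S →ᵇ ℝ, Set.EqOn χ 0 K ∧ Set.EqOn χ 1 Gᶜ ∧ ∀ x, χ x ∈ Set.Icc (0 : ℝ) 1 := by
  -- Urysohn's lemma in the Stone–Čech compactification.
  obtain ⟨V, hV, rfl⟩ := isInducing_stoneCechUnit.isOpen_iff.1 hG
  obtain ⟨χ, hχK, hχV, hχ⟩ := exists_bounded_zero_one_of_closed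
    (hK.image continuous_stoneCechUnit).isClosed hV.isClosed_compl
    (Set.disjoint_compl_right_iff_subset.2 (Set.image_subset_iff.2 hKG))
  exact ⟨χ.compContinuous ⟨stoneCechUnit, continuous_stoneCechUnit⟩,
    fun x hx => hχK (Set.mem_image_of_mem _ hx), fun x hx => hχV hx, fun x => hχ _⟩

variable [MeasurableSpace S] {μ : Measure S} [IsFiniteMeasure μ]

variable (μ) in
theorem exists_boundedContinuous_integral_le_measureReal_compl {K G : Set S}
    (hK : IsCompact K) (hG : IsOpen G) (hKG : K ⊆ G) :
    ∃ χ : S →ᵇ ℝ, 0 ≤ χ ∧ Set.EqOn χ 1 Gᶜ ∧ ∫ x, χ x ∂μ ≤ μ.real Kᶜ := by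
  obtain ⟨χ, hχK, hχG, hχ⟩ := exists_boundedContinuous_zero_one_of_isCompact hK hG hKG
  refine ⟨χ, fun x => (hχ x).1, hχG, ?_⟩
  have hsupport : Function.support χ ⊆ Kᶜ := fun x hx hxK => hx (hχK hxK)
  calc ∫ x, χ x ∂μ = ∫ x in Function.support χ, χ x ∂μ := setIntegral_support.symm
    _ ≤ ‖∫ x in Function.support χ, χ x ∂μ‖ := Real.le_norm_self _
    _ ≤ 1 * μ.real (Function.support χ) :=
        norm_setIntegral_le_of_norm_le_const (measure_lt_top μ _) fun x _ => by
          rw [Real.norm_of_nonneg (hχ x).1]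
          exact (hχ x).2
    _ ≤ μ.real Kᶜ := by
        rw [one_mul]
        exact measureReal_mono hsupport

theorem exists_boundedContinuous_dist_le_integral_lt [OpensMeasurableSpace S]
    (hμ : IsTightMeasureSet {μ}) (hg : TendstoLocallyUniformly g F p)
    {C : ℝ} (hC : ∀ i x, dist (g i x) (F x) ≤ C) {ε : ℝ} (hε : 0 < ε) :
    ∃ χ : S →ᵇ ℝ, (∀ᶠ i in p, ∀ x, dist (g i x) (F x) ≤ χ x) ∧ ∫ x, χ x ∂μ < ε := by
  obtain ⟨δ, hδ, hδε⟩ : ∃ δ > 0, δ * (μ.real Set.univ + |C|) < ε :=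
    (exists_pos_mul_lt hε _).imp fun δ h => ⟨h.1, mul_comm δ _ ▸ h.2⟩
  obtain ⟨K, hK, hμK⟩ := isTightMeasureSet_iff_exists_isCompact_measure_compl_le.1 hμ
    (ENNReal.ofReal δ) (ENNReal.ofReal_pos.2 hδ)
  have hμK' : μ.real Kᶜ ≤ δ := ENNReal.toReal_le_of_le_ofReal hδ.le (hμK μ rfl)
  obtain ⟨G, hG, hKG, hclose⟩ := exists_isOpen_superset_eventually_forall_dist_lt hg hK hδ
  obtain ⟨χ, hχ0, hχ1, hχ⟩ :=
    exists_boundedContinuous_integral_le_measureReal_compl μ hK hG hKG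
  refine ⟨BoundedContinuousFunction.const S δ + |C| • χ, ?_, ?_⟩
  · filter_upwards [hclose] with i hi x
    change dist (g i x) (F x) ≤ δ + |C| * χ x
    by_cases hx : x ∈ G
    · exact (hi x hx).le.trans (le_add_of_nonneg_right (mul_nonneg (abs_nonneg C) (hχ0 x)))
    · have hχx : χ x = 1 := hχ1 hx
      rw [hχx, mul_one]
      linarith [hC i x, le_abs_self C]
  · calc ∫ x, δ + |C| * χ x ∂μ = δ * μ.real Set.univ + |C| * ∫ x, χ x ∂μ := by
          rw [integral_add (integrable_const δ) ((χ.integrable μ).const_mul |C|), integral_const,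
            integral_const_mul, smul_eq_mul, mul_comm δ]
      _ ≤ δ * μ.real Set.univ + |C| * δ := by gcongr; exact hχ.trans hμK'
      _ < ε := by linarith

end TightMeasure

section ContinuousMapping

variable {S : Type*} [TopologicalSpace S] [MeasurableSpace S]
  {Ω : ℕ → Type*} [∀ n, MeasurableSpace (Ω n)] {P : ∀ n, Measure (Ω n)} [∀ n, IsFiniteMeasure (P n)]
  {Z : ∀ n, Ω n → S} {ν : ProbabilityMeasure S} {g : ℕ → S → ℝ} {c : ℝ}

theorem ConvergesWeakly.eventually_lt_outerExpectation (hZ : ConvergesWeakly P Z ν) {u : S →ᵇ ℝ}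
    (hg : ∀ n, BddAbove (Set.range (g n))) (hug : ∀ᶠ n in atTop, ∀ x, u x ≤ g n x)
    (hc : c < ∫ x, u x ∂(ν : Measure S)) :
    ∀ᶠ n in atTop, c < outerExpectation (P n) (fun ω => g n (Z n ω)) := by
  filter_upwards [hug, (hZ u).eventually_const_lt hc] with n hn hlt
  exact hlt.trans_le (outerExpectation_mono
    (u.isBounded_range.bddBelow.mono (Set.range_comp_subset_range _ _))
    ((hg n).mono (Set.range_comp_subset_range _ _)) fun ω => hn (Z n ω))

theorem ConvergesWeakly.eventually_outerExpectation_lt (hZ : ConvergesWeakly P Z ν) {u : S →ᵇ ℝ}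
    (hg : ∀ n, BddBelow (Set.range (g n))) (hgu : ∀ᶠ n in atTop, ∀ x, g n x ≤ u x)
    (hc : ∫ x, u x ∂(ν : Measure S) < c) :
    ∀ᶠ n in atTop, outerExpectation (P n) (fun ω => g n (Z n ω)) < c := by
  filter_upwards [hgu, (hZ u).eventually_lt_const hc] with n hn hlt
  exact (outerExpectation_mono ((hg n).mono (Set.range_comp_subset_range _ _))
    (u.isBounded_range.bddAbove.mono (Set.range_comp_subset_range _ _))
    fun ω => hn (Z n ω)).trans_lt hlt

variable [CompletelyRegularSpace S] [OpensMeasurableSpace S]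

theorem ConvergesWeakly.tendsto_outerExpectation_of_tendstoLocallyUniformly
    (hZ : ConvergesWeakly P Z ν) (hν : IsTightMeasureSet {(ν : Measure S)}) {F : S →ᵇ ℝ}
    (hg : TendstoLocallyUniformly g F atTop) (hgc : ∀ n x, |g n x| ≤ c) :
    Tendsto (fun n => outerExpectation (P n) (fun ω => g n (Z n ω))) atTop
      (𝓝 (∫ x, F x ∂(ν : Measure S))) := by
  have hdist : ∀ n x, dist (g n x) (F x) ≤ c + ‖F‖ := fun n x =>
    (dist_le_norm_add_norm _ _).trans (add_le_add (hgc n x) (F.norm_coe_le_norm x))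
  refine tendsto_order.2 ⟨fun a ha => ?_, fun b hb => ?_⟩
  · obtain ⟨χ, hχ, hχi⟩ := exists_boundedContinuous_dist_le_integral_lt hν hg hdist (sub_pos.2 ha)
    refine hZ.eventually_lt_outerExpectation (u := F - χ)
      (fun n => ⟨c, Set.forall_mem_range.2 fun x => (abs_le.1 (hgc n x)).2⟩)
      (hχ.mono fun n hn x => sub_le_of_abs_sub_le_left (hn x)) ?_
    simp only [BoundedContinuousFunction.coe_sub, Pi.sub_apply]
    rw [integral_sub (F.integrable _) (χ.integrable _)]
    linarith
  · obtain ⟨χ, hχ, hχi⟩ := exists_boundedContinuous_dist_le_integral_lt hν hg hdist (sub_pos.2 hb)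
    refine hZ.eventually_outerExpectation_lt (u := F + χ)
      (fun n => ⟨-c, Set.forall_mem_range.2 fun x => (abs_le.1 (hgc n x)).1⟩)
      (hχ.mono fun n hn x => sub_le_iff_le_add'.1 (abs_le.1 (hn x)).2) ?_
    simp only [BoundedContinuousFunction.coe_add, Pi.add_apply]
    rw [integral_add (F.integrable _) (χ.integrable _)]
    linarith

variable {T : Type*} [TopologicalSpace T] [MeasurableSpace T] [BorelSpace T]

theorem ConvergesWeakly.comp_of_tendsto (hZ : ConvergesWeakly P Z ν)
    (hν : IsTightMeasureSet {(ν : Measure S)}) {G : S → T} (hG : Continuous G) {g : ℕ → S → T}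
    (hg : ∀ x, Tendsto (fun q : ℕ × S => g q.1 q.2) (atTop ×ˢ 𝓝 x) (𝓝 (G x))) :
    ConvergesWeakly P (fun n ω => g n (Z n ω)) (ν.map hG.aemeasurable) := by
  intro f
  have hfg : TendstoLocallyUniformly (fun n x => f (g n x)) (f.compContinuous ⟨G, hG⟩) atTop := by
    refine tendstoLocallyUniformly_iff_forall_tendsto.2 fun x => ?_
    have hfG : Tendsto (fun q : ℕ × S => f (G q.2)) (atTop ×ˢ 𝓝 x) (𝓝 (f (G x))) :=
      ((f.continuous.comp hG).tendsto x).comp tendsto_snd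
    exact (hfG.prodMk_nhds ((f.continuous.tendsto _).comp (hg x))).mono_right
      (nhds_le_uniformity _)
  rw [ProbabilityMeasure.toMeasure_map,
    integral_map hG.aemeasurable f.continuous.measurable.aestronglyMeasurable]
  exact hZ.tendsto_outerExpectation_of_tendstoLocallyUniformly hν hfg
    fun n x => f.norm_coe_le_norm (g n x)

theorem ConvergesWeakly.comp_of_continuousAt (hZ : ConvergesWeakly P Z ν)
    (hν : IsTightMeasureSet {(ν : Measure S)}) {Θ : Type*} [TopologicalSpace Θ] {θ : ℕ → Θ} {a : Θ}
    (hθ : Tendsto θ atTop (𝓝 a)) {g : Θ → S → T} (hga : Continuous (g a))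
    (hg : ∀ x, ContinuousAt (fun q : Θ × S => g q.1 q.2) (a, x)) :
    ConvergesWeakly P (fun n ω => g (θ n) (Z n ω)) (ν.map hga.aemeasurable) :=
  hZ.comp_of_tendsto hν hga fun x =>
    (hg x).tendsto.comp ((hθ.comp tendsto_fst).prodMk_nhds tendsto_snd)

end ContinuousMapping

section HadamardDerivative

variable {D E : Type*} [AddCommGroup D] [Module ℝ D] [TopologicalSpace D]
  [AddCommGroup E] [Module ℝ E] [TopologicalSpace E] {φ : D → E}

theorem HasHadamardDerivAt.hasDerivAt_comp_line {L : D →L[ℝ] E} {θ z : D} {τ : ℝ}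
    (h : HasHadamardDerivAt φ L (θ + τ • z)) (l : E →L[ℝ] ℝ) :
    HasDerivAt (fun s : ℝ => l (φ (θ + s • z))) (l (L z)) τ := by
  rw [hasDerivAt_iff_tendsto_slope_zero]
  refine tendsto_of_seq_tendsto fun t ht => ?_
  obtain ⟨ht0, hne⟩ := tendsto_nhdsWithin_iff.1 ht
  obtain ⟨N, hN⟩ := eventually_atTop.1 hne
  rw [← tendsto_add_atTop_iff_nat N]
  have hquot := h (fun n => t (n + N)) (fun _ => z) z (fun n => hN _ (Nat.le_add_left _ _))
    ((tendsto_add_atTop_iff_nat N).2 ht0) tendsto_const_nhds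
  refine ((l.continuous.tendsto _).comp hquot).congr fun n => ?_
  simp [add_smul, add_assoc]

theorem inv_smul_sub_mem_of_forall_hasHadamardDerivAt [IsTopologicalAddGroup E]
    [ContinuousSMul ℝ E] {L : ℝ → D →L[ℝ] E} {θ z : D} {t : ℝ} (ht : 0 < t) {C : Set E}
    (hC : Convex ℝ C) (hCo : IsOpen C)
    (hφ : ∀ τ ∈ Set.Icc 0 t, HasHadamardDerivAt φ (L τ) (θ + τ • z))
    (hL : ∀ τ ∈ Set.Ioo 0 t, L τ z ∈ C) :
    t⁻¹ • (φ (θ + t • z) - φ θ) ∈ C := by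
  by_contra hx
  obtain ⟨l, hl⟩ := geometric_hahn_banach_open_point hC hCo hx
  have hderiv : ∀ τ ∈ Set.Icc 0 t, HasDerivAt (fun s : ℝ => l (φ (θ + s • z))) (l (L τ z)) τ :=
    fun τ hτ => (hφ τ hτ).hasDerivAt_comp_line l
  obtain ⟨τ, hτ, hslope⟩ := exists_hasDerivAt_eq_slope _ _ ht
    (fun τ hτ => (hderiv τ hτ).continuousAt.continuousWithinAt)
    fun τ hτ => hderiv τ (Set.Ioo_subset_Icc_self hτ)
  refine (hl _ (hL τ hτ)).ne ?_
  rw [hslope]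
  simp [div_eq_inv_mul]

theorem eventually_forall_segment_mem [ContinuousAdd D] [ContinuousSMul ℝ D] {θ z : D}
    {s : Set (D × D)} (hs : s ∈ 𝓝 (θ, z)) :
    ∀ᶠ p : ℝ × D × D in 𝓝[>] 0 ×ˢ 𝓝 (θ, z),
      ∀ τ ∈ Set.Icc 0 p.1, (p.2.1 + τ • p.2.2, p.2.2) ∈ s := by
  have hline : Tendsto (fun p : ℝ × D × D => (p.2.1 + p.1 • p.2.2, p.2.2)) (𝓝 0 ×ˢ 𝓝 (θ, z))
      (𝓝 (θ, z)) := by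
    have hcont : Continuous fun p : ℝ × D × D => (p.2.1 + p.1 • p.2.2, p.2.2) := by fun_prop
    simpa [nhds_prod_eq] using hcont.tendsto (0, θ, z)
  obtain ⟨A, hA, B, hB, hAB⟩ := eventually_prod_iff.1 (hline.eventually hs)
  obtain ⟨δ, hδ, hball⟩ := Metric.eventually_nhds_iff.1 hA
  have hsmall : ∀ᶠ t : ℝ in 𝓝[>] 0, t ∈ Set.Ioo 0 δ := Ioo_mem_nhdsGT hδ
  filter_upwards [hsmall.prod_mk hB] with p hp τ hτ
  have hτδ : dist τ 0 < δ := by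
    rw [Real.dist_eq, sub_zero, abs_of_nonneg hτ.1]
    exact hτ.2.trans_lt hp.1.2
  exact hAB (hball hτδ) hp.2

variable {φ' : D → D →L[ℝ] E} {U : Set D} {a : D}

theorem HasContinuousHadamardDerivOn.continuousAt_deriv (h : HasContinuousHadamardDerivOn φ φ' U)
    (hU : U ∈ 𝓝 a) (z : D) : ContinuousAt (fun p : D × D => φ' p.1 p.2) (a, z) :=
  h.2.continuousAt (prod_mem_nhds hU univ_mem)

variable [IsTopologicalAddGroup E] [ContinuousSMul ℝ E] [LocallyConvexSpace ℝ E]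

theorem HasContinuousHadamardDerivOn.tendsto_inv_smul_sub [ContinuousAdd D] [ContinuousSMul ℝ D]
    (h : HasContinuousHadamardDerivOn φ φ' U) (hU : U ∈ 𝓝 a) (z : D) :
    Tendsto (fun p : ℝ × D × D => p.1⁻¹ • (φ (p.2.1 + p.1 • p.2.2) - φ p.2.1))
      (𝓝[>] 0 ×ˢ 𝓝 (a, z)) (𝓝 (φ' a z)) := by
  refine (LocallyConvexSpace.convex_basis (𝕜 := ℝ) (φ' a z)).tendsto_right_iff.2 ?_
  rintro C ⟨hCmem, hC⟩
  have hnear : ∀ᶠ q : D × D in 𝓝 (a, z), q.1 ∈ U ∧ φ' q.1 q.2 ∈ interior C :=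
    (continuousAt_fst.eventually_mem hU).and
      ((h.continuousAt_deriv hU z).eventually (interior_mem_nhds.2 hCmem))
  have hpos : ∀ᶠ t : ℝ in 𝓝[>] 0, 0 < t := self_mem_nhdsWithin
  filter_upwards [tendsto_fst.eventually hpos, eventually_forall_segment_mem hnear] with p hp hseg
  exact interior_subset (inv_smul_sub_mem_of_forall_hasHadamardDerivAt hp hC.interior
    isOpen_interior (fun τ hτ => h.1 _ (hseg τ hτ).1)
    fun τ hτ => (hseg τ (Set.Ioo_subset_Icc_self hτ)).2)

theorem HasContinuousHadamardDerivOn.convergesWeakly_smul_sub [IsTopologicalAddGroup D]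
    [ContinuousSMul ℝ D] [MeasurableSpace D] [OpensMeasurableSpace D]
    [MeasurableSpace E] [BorelSpace E]
    {Ω : ℕ → Type*} [∀ n, MeasurableSpace (Ω n)] {P : ∀ n, Measure (Ω n)}
    [∀ n, IsFiniteMeasure (P n)] {X : ∀ n, Ω n → D} {ν : ProbabilityMeasure D} {θ : ℕ → D}
    {r : ℕ → ℝ} (h : HasContinuousHadamardDerivOn φ φ' U) (hU : U ∈ 𝓝 a)
    (hθ : Tendsto θ atTop (𝓝 a)) (hr : Tendsto r atTop atTop)
    (hX : ConvergesWeakly P (fun n ω => r n • (X n ω - θ n)) ν)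
    (hν : IsTightMeasureSet {(ν : Measure D)}) :
    ConvergesWeakly P (fun n ω => r n • (φ (X n ω) - φ (θ n)))
      (ν.map (φ' a).continuous.aemeasurable) := by
  let _ : UniformSpace D := IsTopologicalAddGroup.rightUniformSpace D
  have hquot : ConvergesWeakly P
      (fun n ω => (r n)⁻¹⁻¹ • (φ (θ n + (r n)⁻¹ • r n • (X n ω - θ n)) - φ (θ n)))
      (ν.map (φ' a).continuous.aemeasurable) :=
    hX.comp_of_tendsto hν (φ' a).continuous
      (g := fun n z => (r n)⁻¹⁻¹ • (φ (θ n + (r n)⁻¹ • z) - φ (θ n))) fun z =>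
        (h.tendsto_inv_smul_sub hU z).comp
          (((tendsto_inv_atTop_nhdsGT_zero.comp hr).comp tendsto_fst).prodMk
            ((hθ.comp tendsto_fst).prodMk_nhds tendsto_snd))
  refine fun f => (hquot f).congr' ?_
  filter_upwards [hr.eventually_ne_atTop 0] with n hn
  simp only [inv_smul_smul₀ hn, inv_inv, add_sub_cancel]

end HadamardDerivative

end RelWeak

theorem mainTheorem10_general
    {D E : Type*}
    [AddCommGroup D] [Module ℝ D] [TopologicalSpace D] [IsTopologicalAddGroup D]
    [ContinuousSMul ℝ D] [MeasurableSpace D] [OpensMeasurableSpace D]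
    [AddCommGroup E] [Module ℝ E] [TopologicalSpace E] [IsTopologicalAddGroup E]
    [ContinuousSMul ℝ E] [LocallyConvexSpace ℝ E]
    {Ω : ℕ → Type*} [∀ n, MeasurableSpace (Ω n)]
    (P : ∀ n, Measure (Ω n)) [∀ n, IsFiniteMeasure (P n)]
    {Ω' : ℕ → Type*} [∀ n, MeasurableSpace (Ω' n)]
    (P' : ∀ n, Measure (Ω' n)) [∀ n, IsFiniteMeasure (P' n)]
    (D₀ : Set D) (hD₀ : IsOpen D₀)
    (φ : D → E) (φ' : D → D →L[ℝ] E)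
    (hφ : RelWeak.HasContinuousHadamardDerivOn φ φ' D₀)
    (θ : ℕ → D) (hθ : RelWeak.IsRelativelyCompactSeqIn D₀ θ)
    (r : ℕ → ℝ) (hr : Tendsto r atTop atTop)
    (X : ∀ n, Ω n → D) (Y : ∀ n, Ω' n → D)
    (hY : RelWeak.IsRelativelyCompact P' Y)
    (hXY : RelWeak.RelativelyWeaklyConvergent P (fun n ω => r n • (X n ω - θ n)) P' Y) :
    RelWeak.RelativelyWeaklyConvergent
      P (fun n ω => r n • (φ (X n ω) - φ (θ n)))
      P' (fun n ω => φ' (θ n) (Y n ω)) := by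
  borelize E
  let _ : UniformSpace D := IsTopologicalAddGroup.rightUniformSpace D
  refine RelWeak.relativelyWeaklyConvergent_of_subseq fun k hk => ?_
  obtain ⟨l, hl, a, ha, hθa⟩ := hθ k hk
  obtain ⟨m, hm, ν, hν, hYν⟩ := hY (k ∘ l) (hk.comp hl)
  have hj : Tendsto (fun i => k (l (m i))) atTop atTop := ((hk.comp hl).comp hm).tendsto_atTop
  have hθj : Tendsto (fun i => θ (k (l (m i)))) atTop (𝓝 a) := hθa.comp hm.tendsto_atTop
  have hXν := (hXY.comp_tendsto hj).convergesWeakly hYν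
  have hU : D₀ ∈ 𝓝 a := hD₀.mem_nhds ha
  have hφX := hφ.convergesWeakly_smul_sub hU hθj (hr.comp hj) hXν hν
  have hφY := hYν.comp_of_continuousAt hν hθj (g := fun b y => φ' b y) (φ' a).continuous
    (hφ.continuousAt_deriv hU)
  exact ⟨l ∘ m, hφX.relativelyWeaklyConvergent hφY⟩

theorem mainTheorem10
    {D E : Type*}
    [AddCommGroup D] [Module ℝ D] [TopologicalSpace D] [IsTopologicalAddGroup D]
    [ContinuousSMul ℝ D] [TopologicalSpace.MetrizableSpace D] [MeasurableSpace D] [BorelSpace D]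
    [AddCommGroup E] [Module ℝ E] [TopologicalSpace E] [IsTopologicalAddGroup E]
    [ContinuousSMul ℝ E] [TopologicalSpace.MetrizableSpace E] [LocallyConvexSpace ℝ E]
    {Ω : ℕ → Type*} [∀ n, MeasurableSpace (Ω n)]
    (P : ∀ n, Measure (Ω n)) [∀ n, IsProbabilityMeasure (P n)]
    {Ω' : ℕ → Type*} [∀ n, MeasurableSpace (Ω' n)]
    (P' : ∀ n, Measure (Ω' n)) [∀ n, IsProbabilityMeasure (P' n)]
    (D₀ : Set D) (hD₀ : IsOpen D₀)
    (φ : D → E) (φ' : D → D →L[ℝ] E)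
    (hφ : RelWeak.HasContinuousHadamardDerivOn φ φ' D₀)
    (θ : ℕ → D) (hθ_mem : ∀ n, θ n ∈ D₀) (hθ : RelWeak.IsRelativelyCompactSeqIn D₀ θ)
    (r : ℕ → ℝ) (hr : Tendsto r atTop atTop)
    (X : ∀ n, Ω n → D) (Y : ∀ n, Ω' n → D)
    (hY : RelWeak.IsRelativelyCompact P' Y)
    (hXY : RelWeak.RelativelyWeaklyConvergent P (fun n ω => r n • (X n ω - θ n)) P' Y) :
    RelWeak.RelativelyWeaklyConvergent
      P (fun n ω => r n • (φ (X n ω) - φ (θ n)))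
      P' (fun n ω => φ' (θ n) (Y n ω)) := by
  exact mainTheorem10_general P P' D₀ hD₀ φ φ' hφ θ hθ r hr X Y hY hXY
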